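/- Conventions. $2^{<\omega_1}$ is the set of all $0$-$1$-sequences of countable ordinal length, ordered by extension; $ht(s)=dom(s)$; for $s,t\in 2^{<\omega_1}$ let $D_{s,t}=\{\xi<\min(ht(s),ht(t)): s(\xi)\ne t(\xi)\}$. A Suslin tree here is a subset $S$ of $2^{<\omega_1}$ that is closed under initial segments, has height $\omega_1$, and has no uncountable chain and no uncountable antichain; $<_S$ is its order. $S$ is coherent if $D_{s,t}$ is finite for all $s,t\in S$; a coherent $S$ is complete if, for every $s\in S$ and every $t\in 2^{ht(s)}$ with $D_{s,t}$ finite, $t\in S$. The height order $<_{ho}$ on $2^{<\omega_1}$ compares sequences first by height and, at equal height, by their values at the first place of difference; for a finite set $a$ of sequences, $a(0),a(1),\dots$ is its $<_{ho}$-increasing enumeration. For a finite set $a$ of ordinals, $a(0),a(1),\dots$ is its increasing enumeration. For $0<n<\omega$ let $\mathcal C^0_n$ be the collection of all uncountable $A\subseteq[S]^{2n}$ such that for some $s\in S$: (1) $s^\smallfrown 0<_S a(0)<_S\dots<_S a(n-1)$ and $s^\smallfrown 1<_S a(n)<_S\dots<_S a(2n-1)$ for all $a\in A$; (2) $ht(a(n-1))<ht(a(n))$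 for all $a\in A$; (3) $D_{a(n-1),a(n)}=\{ht(s)\}$ for all $a\in A$; (4) $ht(a(2n-1))<ht(b(0))$ or $ht(b(2n-1))<ht(a(0))$ for all $a\neq b$ in $A$. Let $\mathcal C^0=\bigcup_{0<n<\omega}\mathcal C^0_n$, and for $A\in\mathcal C^0$ let $N_A$ be the $n$ with $A\in\mathcal C^0_n$. For $c:[S]^2\to 2$, $\varphi_0(c)$ is the assertion that for all $0<m<\omega$ and all $A_0,\dots,A_{m-1}\in\mathcal C^0$ (repetitions allowed), all pairwise distinct $s_\alpha\in S$ ($\alpha<\omega_1$) and all $x^i_\alpha\in[A_i]^{<\omega}$ ($i<m$, $\alpha<\omega_1$) such that $\langle x^i_\alpha:\alpha<\omega_1\rangle$ is pairwise disjoint for each $i<m$, there are $\alpha<\beta$ such that $s_\alpha<_S s_\beta$ and, for all $i<m$, $a\in x^i_\alpha$ and $b\in x^i_\beta$, there is $j<2$ with $c(a(k),b(k'))=j$ and $c(a(N_{A_i}+k),b(N_{A_i}+k'))=1-j$ for all $k,k'<N_{A_i}$. $\mathrm{Pr}_1(\omega_1,2,\omega)$ is the assertion that there is $d:[\omega_1]^2\to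 2$ (a witness) such that for all $n<\omega$, all sequences $\langle a_\alpha:\alpha<\omega_1\rangle$ of pairwise disjoint elements of $[\omega_1]^n$ and all $\eta<2$ there are $\alpha<\beta$ with $d(a_\alpha(i),a_\beta(j))=\eta$ for all $i,j<n$. Forcing with $S$ means that longer sequences are stronger conditions; the generic branch is the function $b$ with domain $\omega_1$ for which $b(\alpha)$ is the element of height $\alpha$ of the generic filter. Statement. Let $S$ be a complete coherent Suslin tree and let $c:[S]^2\to 2$ be a coloring such that $\varphi_0(c)$ holds. Then: (a) for every $n<\omega$, all pairwise distinct $s_\alpha\in S$ ($\alpha<\omega_1$), all pairwise disjoint $a_\alpha\in[ht(s_\alpha)]^n$ ($\alpha<\omega_1$) and all $k<2$, there are $\alpha<\beta$ such that $s_\alpha<_S s_\beta$ and $c(s_\alpha\upharpoonright_{a_\alpha(i)},s_\beta\upharpoonright_{a_\beta(j)})=k$ for all $i,j<n$; (b) $\Vdash_S\mathrm{Pr}_1(\omega_1,2,\omega)$, where $\omega_1$ is the first uncountable ordinal of the extension, which is forced to be that of the ground model; and it is forced that a witness is the coloring $c^*:[\omega_1]^2\to 2$ induced from $c$ along the generic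 branch $b$, that is, $c^*(\alpha,\beta)=c(b(\alpha),b(\beta))$ for $\alpha<\beta<\omega_1$. -/

import Mathlib

namespace SuslinForcing

/-! ### Countable ordinals, pairs, and binary sequences of countable length -/

/-- `ω₁`, as the linearly ordered type of all countable ordinals. -/
abbrev Om1 : Type 1 := Set.Iio (Ordinal.omega.{0} 1)

/-- The ordinal successor, as an operation on `ω₁`. -/
noncomputable def Om1.next (α : Om1) : Om1 :=
  ⟨Order.succ α.1, (Cardinal.isSuccLimit_omega 1).succ_lt α.2⟩

/-- `[X]²`: the unordered pairs of distinct elements of `X`. -/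
abbrev Pairs (X : Type*) : Type _ := {e : Sym2 X // ¬ e.IsDiag}

/-- `[X]ⁿ`: the subsets of `X` of size `n`. -/
abbrev Subsets (X : Type*) (n : ℕ) : Type _ := {a : Finset X // a.card = n}

/-- `c(x, y) = k`: the points `x` and `y` are distinct, and the colour of `{x, y}` is `k`. -/
def HasColor {X K : Type*} (c : Pairs X → K) (x y : X) (k : K) : Prop :=
  ∃ h : x ≠ y, c ⟨s(x, y), fun hd => h (Sym2.mk_isDiag_iff.1 hd)⟩ = k

/-- An element of `2^{<ω₁}`: a `0`-`1`-sequence whose length `ht` is a countable ordinal.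
So that equality is plain equality of data, the sequence is continued by `false` (that is, `0`)
from `ht` on; those values carry no information. -/
@[ext]
structure Node : Type 1 where
  ht : Om1
  val : Om1 → Bool
  val_of_le : ∀ ξ, ht ≤ ξ → val ξ = false

namespace Node

/-- `2^{<ω₁}` is ordered by extension: `s ≤ t` if `s` is an initial segment of `t`. -/
instance : PartialOrder Node where
  le s t := s.ht ≤ t.ht ∧ ∀ ξ < s.ht, s.val ξ = t.val ξ
  le_refl s := ⟨le_rfl, fun _ _ => rfl⟩
  le_trans s t u hst htu :=
    ⟨hst.1.trans htu.1, fun ξ h => (hst.2 ξ h).trans (htu.2 ξ (h.trans_le hst.1))⟩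
  le_antisymm s t hst hts := by
    have hh : s.ht = t.ht := le_antisymm hst.1 hts.1
    refine Node.ext hh (funext fun ξ => ?_)
    rcases lt_or_ge ξ s.ht with h | h
    · exact hst.2 ξ h
    · rw [s.val_of_le ξ h, t.val_of_le ξ (hh ▸ h)]

/-- The restriction of `s` to `α` (which is `s` itself if `α ≥ ht s`). -/
noncomputable def restrict (s : Node) (α : Om1) : Node where
  ht := min s.ht α
  val ξ := if ξ < α then s.val ξ else false
  val_of_le ξ h := by
    split_ifs with hξ
    · rcases min_le_iff.1 h with h | h
      · exact s.val_of_le ξ h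
      · exact absurd hξ (not_lt.2 h)
    · rfl

theorem restrict_le (s : Node) (α : Om1) : s.restrict α ≤ s := by
  refine ⟨min_le_left _ _, fun ξ h => ?_⟩
  exact if_pos (lt_min_iff.1 h).2

open Classical in
/-- `s⌢i`: the sequence `s` followed by the single entry `i`. -/
noncomputable def snoc (s : Node) (i : Bool) : Node where
  ht := s.ht.next
  val := Function.update s.val s.ht i
  val_of_le ξ h := by
    have hlt : s.ht < ξ := lt_of_lt_of_le (Order.lt_succ s.ht.1) h
    rw [Function.update_of_ne hlt.ne']
    exact s.val_of_le ξ hlt.le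

/-- `D_{s,t}`: the places at which both `s` and `t` are defined and differ. -/
def diffSet (s t : Node) : Set Om1 :=
  {ξ | ξ < s.ht ∧ ξ < t.ht ∧ s.val ξ ≠ t.val ξ}

/-- The height order on `2^{<ω₁}`: first by height, and lexicographically at equal height. -/
def HeightLT (s t : Node) : Prop :=
  s.ht < t.ht ∨
    (s.ht = t.ht ∧ ∃ ξ < s.ht, (∀ ζ < ξ, s.val ζ = t.val ζ) ∧ s.val ξ < t.val ξ)

end Node

/-! ### Complete coherent Suslin trees -/

/-- A Suslin tree of countable binary sequences: a subset of `2^{<ω₁}`, closed under initial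
segments, of height `ω₁`, without uncountable chains and without uncountable antichains. -/
structure IsSuslinTree (S : Set Node) : Prop where
  mem_of_le : ∀ t ∈ S, ∀ s ≤ t, s ∈ S
  height : ∀ α : Om1, ∃ t ∈ S, t.ht = α
  chain : ∀ C ⊆ S, IsChain (· ≤ ·) C → C.Countable
  antichain : ∀ A ⊆ S, IsAntichain (· ≤ ·) A → A.Countable

/-- A complete coherent Suslin tree: any two of its elements differ at finitely many places only,
and it contains every finite modification (of the same length) of each of its elements. -/
structure IsCompleteCoherentSuslinTree (S : Set Node) : Prop extends IsSuslinTree S where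
  coherent : ∀ s ∈ S, ∀ t ∈ S, (Node.diffSet s t).Finite
  complete : ∀ s ∈ S, ∀ t : Node, t.ht = s.ht → (Node.diffSet s t).Finite → t ∈ S

/-! ### The property `φ₀` of a colouring -/

/-- `A ∈ 𝒞⁰ₙ` (for `n > 0`). A set `a ∈ [S]^{2n}` is given by its enumeration
`a(0), …, a(2n-1)` that increases in the height order. The node `s` is the stem of `A`. -/
def InC0 (S : Set Node) (n : ℕ) (hn : 0 < n) (A : Set (Fin (2 * n) → S)) : Prop :=
  ¬ A.Countable ∧ (∀ a ∈ A, ∀ i j, i < j → Node.HeightLT (a i).1 (a j).1) ∧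
  ∃ s ∈ S,
    (∀ a ∈ A,
      s.snoc false < (a ⟨0, by omega⟩).1 ∧
      (∀ i j : Fin (2 * n), i < j → j.1 < n → a i < a j) ∧
      s.snoc true < (a ⟨n, by omega⟩).1 ∧
      (∀ i j : Fin (2 * n), n ≤ i.1 → i < j → a i < a j)) ∧
    (∀ a ∈ A, (a ⟨n - 1, by omega⟩).1.ht < (a ⟨n, by omega⟩).1.ht) ∧
    (∀ a ∈ A, Node.diffSet (a ⟨n - 1, by omega⟩).1 (a ⟨n, by omega⟩).1 = {s.ht}) ∧
    (∀ a ∈ A, ∀ b ∈ A, a ≠ b →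
      (a ⟨2 * n - 1, by omega⟩).1.ht < (b ⟨0, by omega⟩).1.ht ∨
      (b ⟨2 * n - 1, by omega⟩).1.ht < (a ⟨0, by omega⟩).1.ht)

/-- `φ₀(c)`: for all `0 < m < ω` and `A₀, …, A_{m-1}` in `𝒞⁰ = ⋃ₙ 𝒞⁰ₙ` (where `A i` is in
`𝒞⁰_{N i}`), all pairwise distinct `s_α ∈ S` and all finite `x i α ⊆ A i` that are pairwise
disjoint for each fixed `i`, some `α < β` are as described in the last four lines. -/
def Phi0 (S : Set Node) (c : Pairs S → Fin 2) : Prop :=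
  ∀ (m : ℕ), 0 < m → ∀ (N : Fin m → ℕ) (hN : ∀ i, 0 < N i)
    (A : ∀ i, Set (Fin (2 * N i) → S)), (∀ i, InC0 S (N i) (hN i) (A i)) →
  ∀ s : Om1 → S, Function.Injective s →
  ∀ x : ∀ i, Om1 → Finset (Fin (2 * N i) → S), (∀ i α, ∀ a ∈ x i α, a ∈ A i) →
    (∀ i α β, α ≠ β → Disjoint (x i α) (x i β)) →
  ∃ α β, α < β ∧ s α < s β ∧
    ∀ i, ∀ a ∈ x i α, ∀ b ∈ x i β, ∃ j : Fin 2, ∀ k k' : Fin (N i),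
      HasColor c (a ⟨k, by omega⟩) (b ⟨k', by omega⟩) j ∧
      HasColor c (a ⟨N i + k, by omega⟩) (b ⟨N i + k', by omega⟩) (1 - j)

/-! ### Forcing

`P` is a forcing notion, and `q ≤ p` means that `q` is the stronger condition. A formula `φ` of
the forcing language is represented by the set of conditions that force it: `φ p` is `p ⊩ φ`.
The clauses for `∧`, `¬`, `∀` are the usual ones, and `∃`, `→` are the classical abbreviations.

A name for a subset of a ground model set `X` is a set of pairs `(x̌, p)` with `x ∈ X`, `p ∈ P`,
with value `{x : (x, p) ∈ τ for some p ∈ G}` in the extension by `G`. -/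

section Forcing

variable {P : Type*} [Preorder P]

/-- Formulas of the forcing language, `φ p` being `p ⊩ φ`. -/
abbrev Formula (P : Type*) := P → Prop

/-- Statements about ground model objects that have the same meaning in every extension. -/
def fPure (h : Prop) : Formula P := fun _ => h

def fNot (φ : Formula P) : Formula P := fun p => ∀ q ≤ p, ¬ φ q

def fAnd (φ ψ : Formula P) : Formula P := fun p => φ p ∧ ψ p

def fAll {I : Sort*} (φ : I → Formula P) : Formula P := fun p => ∀ i, φ i p

def fImp (φ ψ : Formula P) : Formula P := fNot (fAnd φ (fNot ψ))

def fEx {I : Sort*} (φ : I → Formula P) : Formula P := fNot (fAll fun i => fNot (φ i))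

/-- `P`-names for subsets of the ground model set `X`. -/
abbrev Name (P : Type*) (X : Type*) := Set (X × P)

/-- `p ⊩ x̌ ∈ τ`: the conditions below the condition of some pair `(x, p') ∈ τ` are dense
below `p`. -/
def fMem {X : Type*} (x : X) (τ : Name P X) : Formula P :=
  fun p => ∀ q ≤ p, ∃ r ≤ q, ∃ p' : P, (x, p') ∈ τ ∧ r ≤ p'

/-- `φ` is forced by every condition. -/
def Forced (φ : Formula P) : Prop := ∀ p, φ p

/-- "`f` is a function from `X` to `Y`", for a name `f` of a set of pairs. -/
def fIsFun {X Y : Type*} (f : Name P (X × Y)) : Formula P :=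
  fAnd (fAll fun x : X => fEx fun y : Y => fMem (x, y) f)
    (fAll fun x : X => fAll fun y : Y => fAll fun y' : Y =>
      fImp (fAnd (fMem (x, y) f) (fMem (x, y') f)) (fPure (y = y')))

/-- "The ordinal `ω₁` of the ground model is the first uncountable ordinal": it is not the range
of a function on `ω`, and each smaller ordinal is covered by the range of a function on `ω`. -/
def fOmega1 (P : Type*) [Preorder P] : Formula P :=
  fAnd
    (fAll fun f : Name P (ℕ × Om1) =>
      fNot (fAnd (fIsFun f) (fAll fun ξ : Om1 => fEx fun n : ℕ => fMem (n, ξ) f)))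
    (fAll fun α : Om1 => fEx fun f : Name P (ℕ × Om1) =>
      fAnd (fIsFun f) (fAll fun ξ : Set.Iio α => fEx fun n : ℕ => fMem (n, ξ.1) f))

/-- "`c : [ω₁]² → K` is a witness of `Pr₁(ω₁, K, ω)`": for every `n < ω`, every sequence
`⟨a_α : α < ω₁⟩` of pairwise disjoint elements of `[ω₁]ⁿ` and every `η ∈ K` there are `α < β`
such that `c(x, y) = η` for all `x ∈ a_α` and `y ∈ a_β`. -/
def fWitnessPr1 {K : Type*} (c : Name P (Pairs Om1 × K)) : Formula P :=
  fAnd (fIsFun c) <|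
    fAll fun n : ℕ => fAll fun a : Name P (Om1 × Subsets Om1 n) => fAll fun η : K =>
      fImp
        (fAnd (fIsFun a)
          (fAll fun α : Om1 => fAll fun β : Om1 =>
            fAll fun u : Subsets Om1 n => fAll fun v : Subsets Om1 n =>
              fImp (fAnd (fPure (α ≠ β)) (fAnd (fMem (α, u) a) (fMem (β, v) a)))
                (fPure (Disjoint u.1 v.1))))
        (fEx fun α : Om1 => fEx fun β : Om1 =>
          fEx fun u : Subsets Om1 n => fEx fun v : Subsets Om1 n =>
            fAnd (fPure (α < β)) <| fAnd (fAnd (fMem (α, u) a) (fMem (β, v) a)) <|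
              fAll fun x : u.1 => fAll fun y : v.1 =>
                fEx fun e : Pairs Om1 =>
                  fAnd (fPure (e.1 = s(x.1, y.1))) (fMem (e, η) c))

/-- "`Pr₁(ω₁, K, ω)`", where `ω₁` is the `ω₁` of the extension. -/
def fPr1 (P : Type*) [Preorder P] (K : Type*) : Formula P :=
  fAnd (fOmega1 P) (fEx fun c : Name P (Pairs Om1 × K) => fWitnessPr1 c)

end Forcing

/-! ### Forcing with a tree -/

/-- The forcing notion given by the tree `S`: a longer sequence is a stronger condition. -/
abbrev TreeForcing (S : Set Node) : Type 1 := (↥S)ᵒᵈ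

/-- The restriction map of a set of sequences that is closed under initial segments. -/
noncomputable def treeRestrict {S : Set Node} (hS : IsSuslinTree S) (s : S) (α : Om1) : S :=
  ⟨s.1.restrict α, hS.mem_of_le s.1 s.2 _ (s.1.restrict_le α)⟩

/-- The name for the generic branch `b`, as a function from `ω₁` to `S`: `b(α)` is the element of
height `α` in the generic filter. -/
def branchName (S : Set Node) : Name (TreeForcing S) (Om1 × S) :=
  {z | z.1.2.1.ht = z.1.1 ∧ z.2 = OrderDual.toDual z.1.2}

/-- The name for the colouring `c*` of `[ω₁]²` induced from `c` along the generic branch `b`,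
`c*(α, β) = c(b(α), b(β))`: a condition `s` with `ht s ≥ β > α` decides that
`c*(α, β) = c(s↾α, s↾β)`. -/
def inducedName {S : Set Node} (hS : IsSuslinTree S) (c : Pairs S → Fin 2) :
    Name (TreeForcing S) (Pairs Om1 × Fin 2) :=
  {z | ∃ α β : Om1, α < β ∧ z.1.1.1 = s(α, β) ∧ β ≤ (OrderDual.ofDual z.2).1.ht ∧
    HasColor c (treeRestrict hS (OrderDual.ofDual z.2) α)
      (treeRestrict hS (OrderDual.ofDual z.2) β) z.1.2}

end SuslinForcing

namespace SuslinForcing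

/-! ### Countable sets of countable ordinals -/

namespace Om1

/-! The core is (a); it plays the flip symmetry of `S` against the opposite colours that `φ₀`
produces. Some node `t` is such that every `u ≥ t` is extended by `s α` for arbitrarily large `α`
(`IsSuslinTree.exists_dense_cone`). By recursion of length `ω₁`, pick pairs of indices `(α, β)` such
that `s α` extends `t⌢0` and `s β` extends the node obtained from `s α` by flipping its entry at `ht
t`; completeness keeps flipped nodes in `S`. The restrictions of `s α` to the heights in `a α`,
followed by those of `s β` to the heights in `a β`, form the two halves of a member of a family in
`𝒞⁰ₙ` with stem `t` (`inC0_range_blockPair`).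

Apply `φ₀` with `m = 1` to this family and to the nodes `r` obtained by flipping `s β` back at `ht
t`. It yields two pairs for which the nodes `r` are comparable, with colour `j` between the first
halves and `1 - j` between the second halves. One of these is the desired colour. Comparability of
the nodes `r` passes to the first halves, since `s α ≤ r`, and to the second halves by undoing the
flip (`exists_homogeneous`).

For (b), the countable chain condition preserves `ω₁`. Below a condition that forces a name to be a
sequence of disjoint sets, choose `ω₁` conditions of increasing height, each deciding one member of
the sequence, lying below its height. Then (a) gives two comparable conditions, and the longer one
decides both members and all colours between them (`forced_witness_inducedName`). -/

theorem countable_Iio (δ : Om1) : (Set.Iio δ).Countable := by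
  have h : (Set.Iio δ.1).Countable := by
    rw [← Cardinal.le_aleph0_iff_set_countable, Cardinal.mk_Iio_ordinal]
    have h1 : δ.1.card < Cardinal.aleph 1 := Cardinal.lt_omega_iff_card_lt.1 δ.2
    rw [← Cardinal.succ_aleph0, Order.lt_succ_iff] at h1
    rwa [Cardinal.lift_le_aleph0]
  refine (h.preimage Subtype.val_injective).mono fun x hx => ?_
  exact hx

theorem lt_next (δ : Om1) : δ < δ.next := Order.lt_succ δ.1

theorem next_le {α δ : Om1} (h : α < δ) : α.next ≤ δ := Order.succ_le_of_lt (show α.1 < δ.1 from h)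

theorem le_of_lt_next {α δ : Om1} (h : α < δ.next) : α ≤ δ := not_lt.1 fun h' => (next_le h').not_gt h

theorem countable_Iic (δ : Om1) : (Set.Iic δ).Countable :=
  (countable_Iio δ.next).mono fun _ h => lt_of_le_of_lt h (lt_next δ)

theorem not_countable_univ : ¬ (Set.univ : Set Om1).Countable := by
  rw [← Cardinal.le_aleph0_iff_set_countable, Cardinal.mk_univ, Cardinal.mk_Iio_ordinal]
  simp

/-- Otherwise `ω₁` would be a countable union of countable initial segments. -/
theorem exists_gt_of_countable {C : Set Om1} (hC : C.Countable) : ∃ δ, ∀ x ∈ C, x < δ := by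
  by_contra! h
  refine not_countable_univ ((hC.biUnion fun x _ => countable_Iic x).mono fun δ _ => ?_)
  obtain ⟨x, hx, hδ⟩ := h δ
  exact Set.mem_biUnion hx hδ

/-- Transfinite recursion: choices that are possible above every bound can be made `ω₁` times,
each above all the earlier ones. -/
theorem exists_seq {X : Type*} (R : Om1 → X → Prop) (hR : ∀ δ δ' x, δ ≤ δ' → R δ' x → R δ x)
    (ρ : X → Om1) (h : ∀ δ, ∃ x, R δ x) : ∃ g : Om1 → X,
    (∀ j, ∃ δ, R δ (g j)) ∧ ∀ i j, i < j → R (ρ (g i)) (g j) := by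
  choose F hF using h
  -- Only countably many choices precede stage `j`, so their ranks have a common strict bound.
  have hb : ∀ (j : Om1) (f : ∀ i, i < j → X), ∃ δ, ∀ i hi, ρ (f i hi) < δ := fun j f => by
    have := (countable_Iio j).to_subtype
    obtain ⟨δ, hδ⟩ := exists_gt_of_countable
      (Set.countable_range fun i : Set.Iio j => ρ (f i.1 i.2))
    exact ⟨δ, fun i hi => hδ _ ⟨⟨i, hi⟩, rfl⟩⟩
  choose B hB using hb
  have wf : WellFounded ((· < ·) : Om1 → Om1 → Prop) := wellFounded_lt
  refine ⟨wf.fix fun j f => F (B j f), fun j => ?_, fun i j hij => ?_⟩ <;> rw [wf.fix_eq _ j]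
  · exact ⟨_, hF _⟩
  · exact hR _ _ _ (hB j (fun i _ => wf.fix (fun j f => F (B j f)) i) i hij).le (hF _)

/-- Each of the countably many `ξ ≤ δ` belongs to at most one of the disjoint sets. -/
theorem countable_setOf_not_disjoint {I : Type*} (a : I → Finset Om1)
    (ha : ∀ i j, i ≠ j → Disjoint (a i) (a j)) (δ : Om1) :
    {i | ∃ ξ ∈ a i, ξ ≤ δ}.Countable := by
  have : {i | ∃ ξ ∈ a i, ξ ≤ δ} = ⋃ ξ ∈ Set.Iic δ, {i | ξ ∈ a i} := by
    ext i
    simp [and_comm]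
  rw [this]
  refine (countable_Iic δ).biUnion fun ξ _ => Set.Subsingleton.countable ?_
  intro i hi j hj
  by_contra hij
  exact Finset.disjoint_left.1 (ha i j hij) hi hj

end Om1

/-! ### Binary sequences -/

namespace Node

theorem restrict_ht_of_le {s : Node} {α : Om1} (h : α ≤ s.ht) : (s.restrict α).ht = α :=
  min_eq_right h

theorem restrict_val_of_lt {s : Node} {α ξ : Om1} (h : ξ < α) : (s.restrict α).val ξ = s.val ξ :=
  if_pos h

theorem le_of_le_of_le {s t u : Node} (hs : s ≤ u) (ht : t ≤ u) (h : s.ht ≤ t.ht) : s ≤ t :=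
  ⟨h, fun ξ hξ => (hs.2 ξ hξ).trans (ht.2 ξ (hξ.trans_le h)).symm⟩

theorem eq_of_le_of_le {s t u : Node} (hs : s ≤ u) (ht : t ≤ u) (h : s.ht = t.ht) : s = t :=
  le_antisymm (le_of_le_of_le hs ht h.le) (le_of_le_of_le ht hs h.ge)

theorem restrict_eq_of_le {s t : Node} (h : s ≤ t) {α : Om1} (hα : α ≤ s.ht) :
    s.restrict α = t.restrict α :=
  eq_of_le_of_le ((restrict_le s α).trans h) (restrict_le t α)
    ((restrict_ht_of_le hα).trans (restrict_ht_of_le (hα.trans h.1)).symm)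

theorem restrict_eq_self_of_le {s t : Node} (h : s ≤ t) : t.restrict s.ht = s :=
  eq_of_le_of_le (restrict_le t _) h (restrict_ht_of_le h.1)

/-- The change of the entry of `s` at `ξ`. -/
noncomputable def flip (s : Node) (ξ : Om1) : Node where
  ht := s.ht
  val ζ := if ζ = ξ ∧ ξ < s.ht then !s.val ζ else s.val ζ
  val_of_le ζ h := by
    rw [if_neg, s.val_of_le ζ h]
    rintro ⟨rfl, h'⟩
    exact h.not_gt h'

theorem flip_val_of_ne (s : Node) {ξ ζ : Om1} (h : ζ ≠ ξ) : (s.flip ξ).val ζ = s.val ζ :=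
  if_neg fun h' => h h'.1

theorem flip_val_self {s : Node} {ξ : Om1} (h : ξ < s.ht) : (s.flip ξ).val ξ = !s.val ξ :=
  if_pos ⟨rfl, h⟩

theorem flip_flip (s : Node) (ξ : Om1) : (s.flip ξ).flip ξ = s := by
  ext ζ
  · rfl
  · by_cases h : ζ = ξ ∧ ξ < s.ht <;> simp [flip, h]

theorem flip_mono {s t : Node} (h : s ≤ t) {ξ : Om1} (hξ : ξ < s.ht) : s.flip ξ ≤ t.flip ξ := by
  refine ⟨h.1, fun ζ hζ => ?_⟩
  by_cases hζξ : ζ = ξ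
  · subst hζξ
    rw [flip_val_self hξ, flip_val_self (hξ.trans_le h.1), h.2 ζ hζ]
  · rw [flip_val_of_ne _ hζξ, flip_val_of_ne _ hζξ, h.2 ζ hζ]

theorem diffSet_flip_subset (s : Node) (ξ : Om1) : diffSet s (s.flip ξ) ⊆ {ξ} := by
  rintro ζ ⟨-, -, h⟩
  by_contra h'
  exact h (flip_val_of_ne s h').symm

theorem diffSet_eq_of_flip_le {s t : Node} {ξ : Om1} (hξ : ξ < s.ht) (h : s.flip ξ ≤ t) :
    diffSet s t = {ξ} := by
  ext ζ
  constructor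
  · rintro ⟨h1, h2, h3⟩
    by_contra h'
    exact h3 ((flip_val_of_ne s h').symm.trans (h.2 ζ h1))
  · rintro rfl
    refine ⟨hξ, hξ.trans_le h.1, ?_⟩
    rw [← h.2 ζ hξ, flip_val_self hξ]
    simp

theorem snoc_val_self (s : Node) (i : Bool) : (s.snoc i).val s.ht = i := by simp [snoc]

theorem snoc_val_of_ne (s : Node) (i : Bool) {ξ : Om1} (h : ξ ≠ s.ht) :
    (s.snoc i).val ξ = s.val ξ := by simp [snoc, h]

theorem le_snoc (s : Node) (i : Bool) : s ≤ s.snoc i :=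
  ⟨(Om1.lt_next _).le, fun _ h => (snoc_val_of_ne s i h.ne).symm⟩

theorem flip_snoc (s : Node) (i : Bool) : (s.snoc i).flip s.ht = s.snoc !i := by
  have hlt : s.ht < (s.snoc i).ht := Om1.lt_next _
  refine Node.ext rfl (funext fun ξ => ?_)
  by_cases h : ξ = s.ht
  · subst h
    rw [flip_val_self hlt, snoc_val_self, snoc_val_self]
  · rw [flip_val_of_ne _ h, snoc_val_of_ne _ _ h, snoc_val_of_ne _ _ h]

/-- The sequence that agrees with `t` below `ht t`, and with `u` from there on. -/
noncomputable def graft (t u : Node) (h : t.ht ≤ u.ht) : Node where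
  ht := u.ht
  val ξ := if ξ < t.ht then t.val ξ else u.val ξ
  val_of_le ξ hξ := by rw [if_neg (h.trans hξ).not_gt, u.val_of_le ξ hξ]

theorem le_graft (t u : Node) (h : t.ht ≤ u.ht) : t ≤ graft t u h :=
  ⟨h, fun _ hξ => (if_pos hξ).symm⟩

/-- With coherence this makes the graft a finite modification of `u`, so that completeness puts it
into the tree. -/
theorem diffSet_graft_subset (t u : Node) (h : t.ht ≤ u.ht) :
    diffSet u (graft t u h) ⊆ diffSet t u := by
  rintro ξ ⟨h1, -, h3⟩
  by_cases hξ : ξ < t.ht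
  · refine ⟨hξ, h1, ?_⟩
    simpa [graft, hξ, eq_comm] using h3
  · simp [graft, hξ] at h3

end Node

/-! ### Suslin trees -/

theorem IsSuslinTree.countable_of_isAntichain {S : Set Node} (hS : IsSuslinTree S) {A : Set S}
    (hA : IsAntichain (· ≤ ·) A) : A.Countable := by
  have h := hS.antichain (Subtype.val '' A) (by simp) (by
    rintro _ ⟨x, hx, rfl⟩ _ ⟨y, hy, rfl⟩ hxy
    exact hA hx hy fun h => hxy (congrArg Subtype.val h))
  exact Set.countable_of_injective_of_countable_image Subtype.val_injective.injOn h

/-- Each level is an antichain, and only countably many levels are involved. -/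
theorem IsSuslinTree.countable_setOf_ht_le {S : Set Node} (hS : IsSuslinTree S) (δ : Om1) :
    {s : S | s.1.ht ≤ δ}.Countable := by
  have : {s : S | s.1.ht ≤ δ} = ⋃ ξ ∈ Set.Iic δ, {s : S | s.1.ht = ξ} := by
    ext s
    simp only [Set.mem_ofPred_eq, Set.mem_iUnion, Set.mem_Iic, exists_prop, exists_eq_right']
  rw [this]
  refine (Om1.countable_Iic δ).biUnion fun ξ _ => hS.countable_of_isAntichain ?_
  intro s hs t ht hst h
  exact hst (Subtype.ext (Node.eq_of_le_of_le h le_rfl (hs.trans ht.symm)))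

/-- Pairwise incompatible conditions form a countable family. -/
theorem IsSuslinTree.countable_of_incompatible {S : Set Node} (hS : IsSuslinTree S) {I : Type*}
    {C : Set I} (s : I → S) (h : ∀ i ∈ C, ∀ j ∈ C, i ≠ j → ∀ r, s i ≤ r → ¬ s j ≤ r) :
    C.Countable := by
  have hinj : Set.InjOn s C := fun i hi j hj hij => by
    by_contra hne
    exact h i hi j hj hne _ le_rfl hij.ge
  refine Set.countable_of_injective_of_countable_image hinj ?_
  refine hS.countable_of_isAntichain ?_
  rintro _ ⟨i, hi, rfl⟩ _ ⟨j, hj, rfl⟩ hne hle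
  exact h i hi j hj (fun hij => hne (congrArg s hij)) _ hle le_rfl

theorem treeRestrict_ht {S : Set Node} (hS : IsSuslinTree S) {s : S} {α : Om1} (h : α ≤ s.1.ht) :
    (treeRestrict hS s α).1.ht = α := Node.restrict_ht_of_le h

theorem treeRestrict_le {S : Set Node} (hS : IsSuslinTree S) (s : S) (α : Om1) :
    treeRestrict hS s α ≤ s := Node.restrict_le s.1 α

theorem treeRestrict_eq_of_le {S : Set Node} (hS : IsSuslinTree S) {s t : S} (h : s ≤ t)
    {α : Om1} (hα : α ≤ s.1.ht) : treeRestrict hS s α = treeRestrict hS t α :=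
  Subtype.ext (Node.restrict_eq_of_le h hα)

theorem treeRestrict_eq_self_of_le {S : Set Node} (hS : IsSuslinTree S) {s t : S} (h : s ≤ t) :
    treeRestrict hS t s.1.ht = s := Subtype.ext (Node.restrict_eq_self_of_le h)

/-- Graft `t` onto any node of sufficient height. -/
theorem IsCompleteCoherentSuslinTree.exists_ge {S : Set Node}
    (hS : IsCompleteCoherentSuslinTree S) (t : S) (δ : Om1) : ∃ s, t ≤ s ∧ δ ≤ s.1.ht := by
  obtain ⟨u, hu, hh⟩ := hS.height (max δ t.1.ht)
  have h : t.1.ht ≤ u.ht := hh ▸ le_max_right _ _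
  refine ⟨⟨t.1.graft u h, hS.complete u hu _ rfl ?_⟩, Node.le_graft _ _ h, ?_⟩
  · exact (hS.coherent t.1 t.2 u hu).subset (Node.diffSet_graft_subset _ _ h)
  · exact (le_max_left δ t.1.ht).trans hh.ge

theorem IsCompleteCoherentSuslinTree.flip_mem {S : Set Node}
    (hS : IsCompleteCoherentSuslinTree S) {s : Node} (hs : s ∈ S) (ξ : Om1) : s.flip ξ ∈ S :=
  hS.complete s hs _ rfl ((Set.finite_singleton ξ).subset (Node.diffSet_flip_subset s ξ))

/-- Some cone of the tree is such that each of its elements is extended by uncountably many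
members of the given sequence. -/
theorem IsSuslinTree.exists_dense_cone {S : Set Node} (hS : IsSuslinTree S) {s : Om1 → S}
    (hs : Function.Injective s) : ∃ t : S, ∀ u, t ≤ u → ∀ δ, ∃ α, δ < α ∧ u ≤ s α := by
  by_contra! hcon
  -- By the contrary assumption the bad nodes are dense. A maximal antichain `A` of bad nodes is
  -- countable, so one bound on the indices serves all of its members.
  let bad : Set S := {u | ∃ δ, ∀ α, δ < α → ¬ u ≤ s α}
  obtain ⟨A, hAb, hA⟩ : ∃ A, (A ⊆ bad ∧ IsAntichain (· ≤ ·) A) ∧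
      ∀ u ∈ bad, ∃ v ∈ A, u ≤ v ∨ v ≤ u := by
    obtain ⟨A, hA⟩ := zorn_subset {A : Set S | A ⊆ bad ∧ IsAntichain (· ≤ ·) A} (by
      intro C hC hchain
      refine ⟨⋃₀ C, ⟨Set.sUnion_subset fun A hA => (hC hA).1, ?_⟩,
        fun A hA => Set.subset_sUnion_of_mem hA⟩
      rintro x ⟨X, hX, hx⟩ y ⟨Y, hY, hy⟩ hxy
      rcases hchain.total hX hY with h | h
      · exact (hC hY).2 (h hx) hy hxy
      · exact (hC hX).2 hx (h hy) hxy)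
    refine ⟨A, hA.prop, fun u hu => ?_⟩
    by_contra! h
    have hins : insert u A ∈ {A : Set S | A ⊆ bad ∧ IsAntichain (· ≤ ·) A} :=
      ⟨Set.insert_subset hu hA.prop.1,
        hA.prop.2.insert (fun v hv _ => (h v hv).2) fun v hv _ => (h v hv).1⟩
    have huA : u ∈ A := hA.le_of_ge hins (Set.subset_insert u A) (Set.mem_insert u A)
    exact (h u huA).1 le_rfl
  have hAc := hS.countable_of_isAntichain hAb.2
  have hex : ∀ u : S, ∃ δ, u ∈ A → ∀ α, δ < α → ¬ u ≤ s α := fun u => by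
    by_cases hu : u ∈ A
    · obtain ⟨δ, hδ⟩ := hAb.1 hu
      exact ⟨δ, fun _ => hδ⟩
    · exact ⟨u.1.ht, fun h => absurd h hu⟩
  choose D hD using hex
  -- From `δ₁` on no `s α` extends a member of `A`; all members of `A` have height below `δ₂`; from
  -- `δ₃` on the nodes `s α` are higher than `δ₂`.
  obtain ⟨δ₁, h₁⟩ := Om1.exists_gt_of_countable (hAc.image D)
  obtain ⟨δ₂, h₂⟩ := Om1.exists_gt_of_countable (hAc.image fun u => u.1.ht)
  obtain ⟨δ₃, h₃⟩ := Om1.exists_gt_of_countable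
    ((hS.countable_setOf_ht_le δ₂).preimage hs)
  have hlarge : δ₂ < (s (max δ₁ δ₃)).1.ht := by
    by_contra h
    exact absurd (h₃ (max δ₁ δ₃) (not_lt.1 h)) (not_lt.2 (le_max_right _ _))
  -- A bad extension `u` of this node is comparable with some `v ∈ A`. Since `v` is lower than the
  -- node, it lies below it, contrary to the choice of `δ₁`.
  obtain ⟨u, hu, δ, hδ⟩ := hcon (s (max δ₁ δ₃))
  obtain ⟨v, hv, huv⟩ := hA u ⟨δ, hδ⟩
  have hv₂ : v.1.ht < (s (max δ₁ δ₃)).1.ht := (h₂ _ ⟨v, hv, rfl⟩).trans hlarge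
  refine hD v hv (max δ₁ δ₃) ((h₁ _ ⟨v, hv, rfl⟩).trans_le (le_max_left _ _)) ?_
  rcases huv with h | h
  · exact absurd (hu.trans h).1 hv₂.not_ge
  · exact Node.le_of_le_of_le h hu hv₂.le


/-! ### Homogeneous pairs in the tree -/

/-- The nodes of `p` at the heights `e`, followed by the nodes of `q` at the heights `f`. -/
noncomputable def blockPair {S : Set Node} (hS : IsSuslinTree S) {n : ℕ} (p q : S)
    (e f : Fin n → Om1) : Fin (2 * n) → S := fun i =>
  if h : i.1 < n then treeRestrict hS p (e ⟨i, h⟩)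
  else treeRestrict hS q (f ⟨i - n, by omega⟩)

section BlockPair

variable {S : Set Node} (hS : IsSuslinTree S) {n : ℕ} (p q : S) (e f : Fin n → Om1)

theorem blockPair_fst (i : Fin (2 * n)) (h : i.1 < n) :
    blockPair hS p q e f i = treeRestrict hS p (e ⟨i, h⟩) := dif_pos h

theorem blockPair_snd (i : Fin (2 * n)) (h : n ≤ i.1) :
    blockPair hS p q e f i = treeRestrict hS q (f ⟨i - n, by omega⟩) := dif_neg (by omega)

theorem blockPair_val (k : Fin n) (h : k.1 < 2 * n) :
    blockPair hS p q e f ⟨k, h⟩ = treeRestrict hS p (e k) := dif_pos k.2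

theorem blockPair_add (k : Fin n) (h : n + k.1 < 2 * n) :
    blockPair hS p q e f ⟨n + k, h⟩ = treeRestrict hS q (f k) := by
  rw [blockPair_snd _ _ _ _ _ _ (Nat.le_add_right _ _)]
  congr 2
  exact Fin.ext (Nat.add_sub_cancel_left n k)

end BlockPair

/-- `p` extends `t⌢i`, and `q` extends the sequence obtained from `p` by changing its entry
at `ht t`; the heights `e` are above `t⌢i`, and the heights `f` are above `p`. -/
structure IsSplitPair {S : Set Node} {n : ℕ} (t p q : S) (e f : Fin n → Om1) : Prop where
  strictMono_left : StrictMono e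
  strictMono_right : StrictMono f
  snoc_le : t.1.snoc false ≤ p.1
  flip_le : p.1.flip t.1.ht ≤ q.1
  next_lt : ∀ i, t.1.ht.next < e i
  left_lt : ∀ i, e i < p.1.ht
  lt_right : ∀ i, p.1.ht < f i
  right_lt : ∀ i, f i < q.1.ht

namespace IsSplitPair

variable {S : Set Node} {hS : IsSuslinTree S} {n : ℕ} {t p q : S} {e f : Fin n → Om1}

theorem ht_fst (h : IsSplitPair t p q e f) (i : Fin (2 * n)) (hi : i.1 < n) :
    (blockPair hS p q e f i).1.ht = e ⟨i, hi⟩ := by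
  rw [blockPair_fst _ _ _ _ _ _ hi, treeRestrict_ht _ (h.left_lt _).le]

theorem ht_snd (h : IsSplitPair t p q e f) (i : Fin (2 * n)) (hi : n ≤ i.1) :
    (blockPair hS p q e f i).1.ht = f ⟨i - n, by omega⟩ := by
  rw [blockPair_snd _ _ _ _ _ _ hi, treeRestrict_ht _ (h.right_lt _).le]

/-- The height of `p` separates the two halves. -/
theorem ht_strictMono (h : IsSplitPair t p q e f) :
    StrictMono fun i => (blockPair hS p q e f i).1.ht := by
  intro i j hij
  have hij' : i.1 < j.1 := hij
  dsimp only
  by_cases hi : i.1 < n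
  · rw [h.ht_fst i hi]
    by_cases hj : j.1 < n
    · rw [h.ht_fst j hj]
      exact h.strictMono_left hij
    · rw [h.ht_snd j (not_lt.1 hj)]
      exact (h.left_lt _).trans (h.lt_right _)
  · rw [h.ht_snd i (not_lt.1 hi), h.ht_snd j (by omega)]
    exact h.strictMono_right (Fin.lt_def.2 (by simp only; omega))

/-- Nodes of the same half are restrictions of one node, `p` or `q`, and so are ordered by height.
-/
theorem blockPair_lt (h : IsSplitPair t p q e f) {i j : Fin (2 * n)} (hij : i < j)
    (hn : j.1 < n ∨ n ≤ i.1) : blockPair hS p q e f i < blockPair hS p q e f j := by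
  have hlt := h.ht_strictMono (hS := hS) hij
  have hij' : i.1 < j.1 := hij
  refine lt_of_le_of_ne ?_ fun heq =>
    hlt.ne (congrArg (fun x : S => x.1.ht) heq)
  obtain ⟨u, hu⟩ : ∃ u : S, blockPair hS p q e f i ≤ u ∧ blockPair hS p q e f j ≤ u := by
    rcases hn with hn | hn
    · refine ⟨p, ?_, ?_⟩
      · rw [blockPair_fst _ _ _ _ _ i (by omega)]
        exact treeRestrict_le _ _ _
      · rw [blockPair_fst _ _ _ _ _ j hn]
        exact treeRestrict_le _ _ _
    · refine ⟨q, ?_, ?_⟩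
      · rw [blockPair_snd _ _ _ _ _ i hn]
        exact treeRestrict_le _ _ _
      · rw [blockPair_snd _ _ _ _ _ j (by omega)]
        exact treeRestrict_le _ _ _
  exact Node.le_of_le_of_le hu.1 hu.2 hlt.le

theorem snoc_lt_of_le {s : S} (i : Bool) (hs : t.1.snoc i ≤ s.1) {ξ : Om1}
    (h : t.1.ht.next < ξ) (hξ : ξ ≤ s.1.ht) : t.1.snoc i < (treeRestrict hS s ξ).1 := by
  have hht : t.1.ht.next < (treeRestrict hS s ξ).1.ht := by rwa [treeRestrict_ht _ hξ]
  refine lt_of_le_of_ne (Node.le_of_le_of_le hs (treeRestrict_le hS s ξ) hht.le) fun heq => ?_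
  rw [← heq] at hht
  exact lt_irrefl _ hht

theorem ht_lt (h : IsSplitPair t p q e f) : t.1.ht < p.1.ht :=
  (Om1.lt_next _).trans_le h.snoc_le.1

theorem snoc_true_le (h : IsSplitPair t p q e f) : t.1.snoc true ≤ q.1 := by
  refine le_trans ?_ h.flip_le
  have := Node.flip_mono h.snoc_le (Om1.lt_next t.1.ht)
  rwa [Node.flip_snoc] at this

/-- The flip at `ht t` carries the restriction of `p` below `q`, hence below the higher restriction
of `q`. -/
theorem diffSet_eq (h : IsSplitPair t p q e f) (i j : Fin (2 * n)) (hi : i.1 < n)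
    (hj : n ≤ j.1) :
    Node.diffSet (blockPair hS p q e f i).1 (blockPair hS p q e f j).1 = {t.1.ht} := by
  have hti : t.1.ht < (blockPair hS p q e f i).1.ht := by
    rw [h.ht_fst i hi]
    exact (Om1.lt_next _).trans (h.next_lt _)
  refine Node.diffSet_eq_of_flip_le hti ?_
  have h1 : (blockPair hS p q e f i).1 ≤ p.1 := by
    rw [blockPair_fst _ _ _ _ _ i hi]
    exact treeRestrict_le _ _ _
  have h2 : (blockPair hS p q e f j).1 ≤ q.1 := by
    rw [blockPair_snd _ _ _ _ _ j hj]
    exact treeRestrict_le _ _ _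
  exact Node.le_of_le_of_le ((Node.flip_mono h1 hti).trans h.flip_le) h2
    (h.ht_strictMono (hS := hS) (Fin.lt_def.2 (by omega))).le

end IsSplitPair

/-- A sequence of split pairs of heights that do not overlap yields a member of `𝒞⁰ₙ`. -/
theorem inC0_range_blockPair {S : Set Node} (hS : IsSuslinTree S) {n : ℕ} (hn : 0 < n) (t : S)
    (p q : Om1 → S) (e f : Om1 → Fin n → Om1)
    (h : ∀ γ, IsSplitPair t (p γ) (q γ) (e γ) (f γ))
    (hlt : ∀ γ δ, γ < δ → ∀ i, (q γ).1.ht < e δ i) :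
    Function.Injective (fun γ => blockPair hS (p γ) (q γ) (e γ) (f γ)) ∧
    InC0 S n hn (Set.range fun γ => blockPair hS (p γ) (q γ) (e γ) (f γ)) := by
  -- This separation gives clause (4), and also the injectivity that makes the range uncountable.
  have hsep : ∀ γ δ, γ < δ →
      (blockPair hS (p γ) (q γ) (e γ) (f γ) ⟨2 * n - 1, by omega⟩).1.ht <
        (blockPair hS (p δ) (q δ) (e δ) (f δ) ⟨0, by omega⟩).1.ht := fun γ δ hγδ => by
    rw [(h γ).ht_snd _ (by simp only; omega), (h δ).ht_fst _ hn]
    exact ((h γ).right_lt _).trans (hlt γ δ hγδ _)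
  have hinj : Function.Injective (fun γ => blockPair hS (p γ) (q γ) (e γ) (f γ)) := by
    have hne : ∀ γ δ, γ < δ → blockPair hS (p γ) (q γ) (e γ) (f γ) ≠
        blockPair hS (p δ) (q δ) (e δ) (f δ) := fun γ δ hγδ heq => by
      have h1 := hsep γ δ hγδ
      rw [heq] at h1
      exact h1.not_ge ((h δ).ht_strictMono.monotone (Fin.le_def.2 (Nat.zero_le _)))
    intro γ δ heq
    rcases lt_trichotomy γ δ with hγδ | hγδ | hγδ
    · exact absurd heq (hne γ δ hγδ)
    · exact hγδ
    · exact absurd heq.symm (hne δ γ hγδ)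
  refine ⟨hinj, ?_, ?_, t.1, t.2, ?_, ?_, ?_, ?_⟩
  · rw [← Set.image_univ]
    exact fun hc => Om1.not_countable_univ
      (Set.countable_of_injective_of_countable_image hinj.injOn hc)
  · rintro _ ⟨γ, rfl⟩ i j hij
    exact Or.inl ((h γ).ht_strictMono hij)
  · rintro _ ⟨γ, rfl⟩
    refine ⟨?_, fun i j hij hj => (h γ).blockPair_lt hij (Or.inl hj), ?_,
      fun i j hi hij => (h γ).blockPair_lt hij (Or.inr hi)⟩
    · dsimp only
      rw [blockPair_fst _ _ _ _ _ _ hn]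
      exact IsSplitPair.snoc_lt_of_le false (h γ).snoc_le ((h γ).next_lt _) ((h γ).left_lt _).le
    · dsimp only
      rw [blockPair_snd _ _ _ _ _ _ le_rfl]
      exact IsSplitPair.snoc_lt_of_le true (h γ).snoc_true_le
        (((h γ).next_lt ⟨0, hn⟩).trans (((h γ).left_lt _).trans ((h γ).lt_right _)))
        ((h γ).right_lt _).le
  · rintro _ ⟨γ, rfl⟩
    exact (h γ).ht_strictMono (Fin.lt_def.2 (by simp only; omega))
  · rintro _ ⟨γ, rfl⟩
    exact (h γ).diffSet_eq _ _ (by simp only; omega) le_rfl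
  · rintro _ ⟨γ, rfl⟩ _ ⟨δ, rfl⟩ hne
    rcases lt_trichotomy γ δ with hγδ | rfl | hγδ
    · exact Or.inl (hsep γ δ hγδ)
    · exact absurd rfl hne
    · exact Or.inr (hsep δ γ hγδ)

/-- Above every bound the sequence contains a member of a given dense cone whose associated
finite set lies above the bound. -/
theorem exists_large_index {S : Set Node} {n : ℕ} {s : Om1 → S} {a : Om1 → Subsets Om1 n}
    (ha : ∀ α β, α ≠ β → Disjoint (a α).1 (a β).1) {t : S}
    (ht : ∀ u, t ≤ u → ∀ δ, ∃ α, δ < α ∧ u ≤ s α) {u : S} (hu : t ≤ u) (δ : Om1) :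
    ∃ α, δ < α ∧ u ≤ s α ∧ ∀ ξ ∈ (a α).1, δ < ξ := by
  obtain ⟨δ', hδ'⟩ := Om1.exists_gt_of_countable
    (Om1.countable_setOf_not_disjoint (fun α => (a α).1) ha δ)
  obtain ⟨α, hα, huα⟩ := ht u hu (max δ δ')
  refine ⟨α, (le_max_left _ _).trans_lt hα, huα, fun ξ hξ => not_le.1 fun hle => ?_⟩
  exact ((le_max_right _ _).trans_lt hα).not_gt (hδ' α ⟨ξ, hξ, hle⟩)

theorem eq_or_one_sub_eq (j k : Fin 2) : j = k ∨ 1 - j = k := by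
  revert j k
  decide

/-- A node above `t`, cut at the next height, differs from `t⌢i` at most at `ht t`. -/
theorem IsCompleteCoherentSuslinTree.snoc_mem {S : Set Node}
    (hS : IsCompleteCoherentSuslinTree S) (t : S) (i : Bool) : t.1.snoc i ∈ S := by
  obtain ⟨v, hv, hh⟩ := hS.exists_ge t t.1.ht.next
  refine hS.complete _ (treeRestrict hS.toIsSuslinTree v t.1.ht.next).2 _
    (treeRestrict_ht _ hh).symm ((Set.finite_singleton t.1.ht).subset ?_)
  rintro ξ ⟨h1, h2, h3⟩
  by_contra hξ
  refine h3 ?_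
  have hlt : ξ < t.1.ht := lt_of_le_of_ne (Om1.le_of_lt_next h2) hξ
  rw [Node.snoc_val_of_ne _ _ hξ, hv.2 ξ hlt]
  exact Node.restrict_val_of_lt h2

/-- In a suitable subtree the sequence splits into pairs `s_α`, `s_β` such that `s_β` extends a
modification of `s_α` at a fixed place; `φ₀` gives opposite colours to the two halves. -/
theorem exists_homogeneous {S : Set Node} (hS : IsCompleteCoherentSuslinTree S)
    {c : Pairs S → Fin 2} (hc : Phi0 S c) (n : ℕ) (s : Om1 → S) (a : Om1 → Subsets Om1 n)
    (k : Fin 2) (hs : Function.Injective s) (has : ∀ α, ∀ ξ ∈ (a α).1, ξ < (s α).1.ht)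
    (ha : ∀ α β, α ≠ β → Disjoint (a α).1 (a β).1) :
    ∃ α β, α < β ∧ s α < s β ∧ ∀ ξ ∈ (a α).1, ∀ ζ ∈ (a β).1,
      HasColor c (treeRestrict hS.toIsSuslinTree (s α) ξ)
        (treeRestrict hS.toIsSuslinTree (s β) ζ) k := by
  obtain ⟨t, ht⟩ := hS.exists_dense_cone hs
  -- `𝒞⁰ₙ` requires `n > 0`; for empty sets any two comparable members of the sequence suffice.
  rcases Nat.eq_zero_or_pos n with rfl | hn
  · obtain ⟨α, -, hα⟩ := ht t le_rfl t.1.ht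
    obtain ⟨β, hβ, hαβ⟩ := ht (s α) hα α
    refine ⟨α, β, hβ, lt_of_le_of_ne hαβ (hs.ne hβ.ne), fun ξ hξ => ?_⟩
    rw [Finset.card_eq_zero.1 (a α).2] at hξ
    exact absurd hξ (Finset.notMem_empty ξ)
  let em : Om1 → Fin n → Om1 := fun α => (a α).1.orderEmbOfFin (a α).2
  have hem : ∀ α i, em α i ∈ (a α).1 := fun α i => Finset.orderEmbOfFin_mem _ _ _
  have hem' : ∀ α, ∀ ξ ∈ (a α).1, ∃ i, em α i = ξ := fun α ξ hξ => by
    have : ξ ∈ Set.range ((a α).1.orderEmbOfFin (a α).2) := by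
      rw [Finset.range_orderEmbOfFin]
      exact hξ
    exact this
  have hmono : ∀ α, StrictMono (em α) := fun α => ((a α).1.orderEmbOfFin (a α).2).strictMono
  -- Only the heights `em x.1` need to exceed the bound: a split pair already puts the heights of
  -- its second half above those of the first.
  let R : Om1 → Om1 × Om1 → Prop := fun δ x =>
    (δ < x.1 ∧ δ < x.2 ∧ ∀ i, δ < em x.1 i) ∧ IsSplitPair t (s x.1) (s x.2) (em x.1) (em x.2)
  obtain ⟨g, hgR, hg⟩ := Om1.exists_seq R
    (fun δ δ' x hle hx => ⟨⟨hle.trans_lt hx.1.1, hle.trans_lt hx.1.2.1,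
      fun i => hle.trans_lt (hx.1.2.2 i)⟩, hx.2⟩)
    (fun x => max (max x.1 x.2) (max (s x.1).1.ht (s x.2).1.ht))
    (by
      intro δ
      obtain ⟨α, hα, hsα, haα⟩ := exists_large_index ha ht
        (u := ⟨t.1.snoc false, hS.snoc_mem t false⟩) (Node.le_snoc t.1 false)
        (max δ t.1.ht.next)
      have hlt : t.1.ht < (s α).1.ht := (Om1.lt_next _).trans_le hsα.1
      have htf : t.1 ≤ (s α).1.flip t.1.ht := by
        have := Node.flip_mono hsα (Om1.lt_next t.1.ht)
        rw [Node.flip_snoc] at this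
        exact (Node.le_snoc _ _).trans this
      obtain ⟨β, hβ, hsβ, haβ⟩ := exists_large_index ha ht
        (u := ⟨(s α).1.flip t.1.ht, hS.flip_mem (s α).2 _⟩) htf (max δ (s α).1.ht)
      exact ⟨(α, β), ⟨(le_max_left _ _).trans_lt hα, (le_max_left _ _).trans_lt hβ,
        fun i => (le_max_left _ _).trans_lt (haα _ (hem α i))⟩, hmono α, hmono β, hsα, hsβ,
        fun i => (le_max_right _ _).trans_lt (haα _ (hem α i)), fun i => has α _ (hem α i),
        fun i => (le_max_right _ _).trans_lt (haβ _ (hem β i)), fun i => has β _ (hem β i)⟩)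
  have hsplit : ∀ γ, IsSplitPair t (s (g γ).1) (s (g γ).2) (em (g γ).1) (em (g γ).2) := by
    intro γ
    obtain ⟨δ, hδ⟩ := hgR γ
    exact hδ.2
  have hlt₁ : ∀ γ δ, γ < δ → (g γ).1 < (g δ).1 := fun γ δ h =>
    ((le_max_left _ _).trans (le_max_left _ _)).trans_lt (hg γ δ h).1.1
  have hlt₂ : ∀ γ δ, γ < δ → (g γ).2 < (g δ).2 := fun γ δ h =>
    ((le_max_right _ _).trans (le_max_left _ _)).trans_lt (hg γ δ h).1.2.1
  have hltp : ∀ γ δ, γ < δ → ∀ i, (s (g γ).1).1.ht < em (g δ).1 i := fun γ δ h i =>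
    ((le_max_left _ _).trans (le_max_right _ _)).trans_lt ((hg γ δ h).1.2.2 i)
  have hltq : ∀ γ δ, γ < δ → ∀ i, (s (g γ).2).1.ht < em (g δ).1 i := fun γ δ h i =>
    ((le_max_right _ _).trans (le_max_right _ _)).trans_lt ((hg γ δ h).1.2.2 i)
  obtain ⟨hinj, hC0⟩ := inC0_range_blockPair hS.toIsSuslinTree hn t (fun γ => s (g γ).1)
    (fun γ => s (g γ).2) (fun γ => em (g γ).1) (fun γ => em (g γ).2) hsplit hltq
  set A : Om1 → Fin (2 * n) → S := fun γ =>
    blockPair hS.toIsSuslinTree (s (g γ).1) (s (g γ).2) (em (g γ).1) (em (g γ).2) with hA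
  -- Flipped back, `s (g γ).2` extends `s (g γ).1`, so a single comparability controls both halves.
  let r : Om1 → S := fun γ => ⟨(s (g γ).2).1.flip t.1.ht, hS.flip_mem (s (g γ).2).2 _⟩
  have hr_inj : Function.Injective r := by
    intro γ δ h
    have h1 : (s (g γ).2).1.flip t.1.ht = (s (g δ).2).1.flip t.1.ht := congrArg Subtype.val h
    have h2 := congrArg (fun u => u.flip t.1.ht) h1
    simp only [Node.flip_flip] at h2
    have h3 : StrictMono fun γ => (g γ).2 := fun γ δ => hlt₂ γ δ
    exact h3.injective (hs (Subtype.ext h2))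
  obtain ⟨γ, δ, hγδ, hrlt, hcol⟩ := hc 1 one_pos (fun _ => n) (fun _ => hn)
    (fun _ => Set.range A) (fun _ => hC0) r hr_inj (fun _ γ => {A γ})
    (fun _ γ b hb => ⟨γ, (Finset.mem_singleton.1 hb).symm⟩)
    (fun _ γ δ h => Finset.disjoint_singleton.2 (hinj.ne h))
  obtain ⟨j, hj⟩ := hcol 0 _ (Finset.mem_singleton_self _) _ (Finset.mem_singleton_self _)
  have hpr : ∀ γ, (s (g γ).1).1 ≤ (r γ).1 := fun γ => by
    have := Node.flip_mono (hsplit γ).flip_le (hsplit γ).ht_lt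
    rwa [Node.flip_flip] at this
  rcases eq_or_one_sub_eq j k with rfl | hjk
  · refine ⟨(g γ).1, (g δ).1, hlt₁ γ δ hγδ, ?_, fun ξ hξ ζ hζ => ?_⟩
    -- Both first nodes lie below `r δ`, so their heights order them.
    · refine lt_of_le_of_ne (Node.le_of_le_of_le ((hpr γ).trans hrlt.le) (hpr δ) ?_)
        (hs.ne (hlt₁ γ δ hγδ).ne)
      exact ((hltp γ δ hγδ ⟨0, hn⟩).trans ((hsplit δ).left_lt _)).le
    · obtain ⟨i, rfl⟩ := hem' _ ξ hξ
      obtain ⟨i', rfl⟩ := hem' _ ζ hζ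
      have := (hj i i').1
      simp only [hA] at this
      rwa [blockPair_val, blockPair_val] at this
  · refine ⟨(g γ).2, (g δ).2, hlt₂ γ δ hγδ, ?_, fun ξ hξ ζ hζ => ?_⟩
    -- Flipping at `ht t` once more turns `r γ < r δ` into the relation between the second nodes.
    · refine lt_of_le_of_ne ?_ (hs.ne (hlt₂ γ δ hγδ).ne)
      have hle : (s (g γ).2).1.flip t.1.ht ≤ (s (g δ).2).1.flip t.1.ht := hrlt.le
      have := Node.flip_mono hle ((hsplit γ).ht_lt.trans_le (hsplit γ).flip_le.1)
      rwa [Node.flip_flip, Node.flip_flip] at this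
    · obtain ⟨i, rfl⟩ := hem' _ ξ hξ
      obtain ⟨i', rfl⟩ := hem' _ ζ hζ
      have := (hj i i').2
      simp only [hA] at this
      rwa [hjk, blockPair_add, blockPair_add] at this


/-! ### The forcing relation -/

section Forcing

variable {P : Type*} [Preorder P]

theorem fEx_iff {I : Sort*} {φ : I → Formula P} {p : P} :
    fEx φ p ↔ ∀ q ≤ p, ∃ r ≤ q, ∃ i, φ i r := by
  simp only [fEx, fNot, fAll, not_forall, not_not]
  refine forall₂_congr fun q _ => ⟨?_, ?_⟩
  · rintro ⟨i, r, hr, h⟩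
    exact ⟨r, hr, i, h⟩
  · rintro ⟨r, hr, i, h⟩
    exact ⟨i, r, hr, h⟩

theorem fImp_iff {φ ψ : Formula P} {p : P} :
    fImp φ ψ p ↔ ∀ q ≤ p, φ q → ∃ r ≤ q, ψ r := by
  simp [fImp, fNot, fAnd]

theorem fMem.mono {X : Type*} {x : X} {τ : Name P X} {p q : P} (h : fMem x τ p) (hq : q ≤ p) :
    fMem x τ q := fun r hr => h r (hr.trans hq)

theorem fMem_of_mem {X : Type*} {x : X} {τ : Name P X} {p : P} (h : (x, p) ∈ τ) : fMem x τ p :=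
  fun q hq => ⟨q, le_rfl, p, h, hq⟩

/-- An instance that is forced by all stronger conditions forces the existential formula. -/
theorem fEx_of {I : Sort*} {φ : I → Formula P} {p : P} (i : I) (h : ∀ q ≤ p, φ i q) :
    fEx φ p := fEx_iff.2 fun q hq => ⟨q, le_rfl, i, h q hq⟩

/-- The implication yields `y = y'` only at some stronger condition, but this statement does not
depend on the condition. -/
theorem fIsFun.eq {X Y : Type*} {f : Name P (X × Y)} {p q : P} (h : fIsFun f p) (hq : q ≤ p)
    {x : X} {y y' : Y} (hy : fMem (x, y) f q) (hy' : fMem (x, y') f q) : y = y' := by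
  obtain ⟨_, _, hr⟩ := fImp_iff.1 (h.2 x y y') q hq ⟨hy, hy'⟩
  exact hr

theorem fIsFun.exists_value {X Y : Type*} {f : Name P (X × Y)} {p q : P} (h : fIsFun f p)
    (hq : q ≤ p) (x : X) : ∃ r ≤ q, ∃ y, fMem (x, y) f r := fEx_iff.1 (h.1 x) q hq

/-- A name is forced to be a function if values are densely decided and unique. -/
theorem fIsFun_of {X Y : Type*} {f : Name P (X × Y)} {p : P}
    (hex : ∀ x, ∀ q ≤ p, ∃ r ≤ q, ∃ y, ((x, y), r) ∈ f)
    (huniq : ∀ x y y' p₁ p₂ r, ((x, y), p₁) ∈ f → ((x, y'), p₂) ∈ f → r ≤ p₁ → r ≤ p₂ → y = y') :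
    fIsFun f p := by
  refine ⟨fun x => fEx_iff.2 fun q hq => ?_, fun x y y' => fImp_iff.2 fun q _ h => ?_⟩
  · obtain ⟨r, hr, y, hy⟩ := hex x q hq
    exact ⟨r, hr, y, fMem_of_mem hy⟩
  · obtain ⟨r, hr, p₁, hp₁, hrp₁⟩ := h.1 q le_rfl
    obtain ⟨r', hr', p₂, hp₂, hrp₂⟩ := h.2 r hr
    exact ⟨q, le_rfl, huniq x y y' p₁ p₂ r' hp₁ hp₂ (hr'.trans hrp₁) hrp₂⟩

end Forcing

/-! ### Forcing with a Suslin tree -/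

section TreeForcing

variable {S : Set Node}

/-- A condition decides the values of a name for a function in countably many ways below it. -/
theorem IsSuslinTree.countable_values (hS : IsSuslinTree S) {X Y : Type*}
    {f : Name (TreeForcing S) (X × Y)} {p : TreeForcing S} (hf : fIsFun f p) (x : X) :
    {y | ∃ q ≤ p, fMem (x, y) f q}.Countable := by
  have hex : ∀ y, ∃ q : S, y ∈ {y | ∃ q ≤ p, fMem (x, y) f q} →
      OrderDual.toDual q ≤ p ∧ fMem (x, y) f (OrderDual.toDual q) := fun y => by
    by_cases hy : ∃ q ≤ p, fMem (x, y) f q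
    · obtain ⟨q, hq⟩ := hy
      exact ⟨OrderDual.ofDual q, fun _ => hq⟩
    · exact ⟨OrderDual.ofDual p, fun h => absurd h hy⟩
  choose q hq using hex
  refine hS.countable_of_incompatible q fun y hy y' hy' hne r hr hr' => hne ?_
  exact hf.eq (q := OrderDual.toDual r) (le_trans (b := OrderDual.toDual (q y)) hr (hq y hy).1)
    ((hq y hy).2.mono hr) ((hq y' hy').2.mono hr')

/-- A function on `ω` has only countably many possible values below a condition, so it misses some
`δ`. Smaller ordinals are enumerated already in the ground model. -/
theorem IsSuslinTree.forced_omega1 (hS : IsSuslinTree S) : Forced (fOmega1 (TreeForcing S)) := by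
  intro p
  refine ⟨fun f q _ hf => ?_, fun α => ?_⟩
  · obtain ⟨δ, hδ⟩ := Om1.exists_gt_of_countable
      (Set.countable_iUnion fun n => hS.countable_values hf.1 n)
    obtain ⟨r, hr, n, hn⟩ := fEx_iff.1 (hf.2 δ) q le_rfl
    exact lt_irrefl δ (hδ δ (Set.mem_iUnion.2 ⟨n, r, hr, hn⟩))
  · obtain ⟨g, hg⟩ : ∃ g : ℕ → Om1, Set.Iio α ⊆ Set.range g := by
      rcases (Set.Iio α).eq_empty_or_nonempty with h | h
      · exact ⟨fun _ => α, h ▸ Set.empty_subset _⟩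
      · obtain ⟨g, hg⟩ := (Om1.countable_Iio α).exists_eq_range h
        exact ⟨g, hg.le⟩
    -- The canonical name of `g`: its pairs carry every condition.
    refine fEx_of {z | z.1.2 = g z.1.1} fun q _ => ⟨fIsFun_of ?_ ?_, fun ξ => ?_⟩
    · exact fun n r _ => ⟨r, le_rfl, g n, rfl⟩
    · intro n y y' _ _ _ h h' _ _
      exact Eq.trans h (Eq.symm h')
    · obtain ⟨n, hn⟩ := hg ξ.2
      exact fEx_of n fun r _ => fMem_of_mem hn.symm

theorem HasColor.exists {X K : Type*} (c : Pairs X → K) {x y : X} (h : x ≠ y) :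
    ∃ k, HasColor c x y k := ⟨_, h, rfl⟩

theorem HasColor.unique {X K : Type*} {c : Pairs X → K} {x y : X} {k k' : K}
    (h : HasColor c x y k) (h' : HasColor c x y k') : k = k' := by
  obtain ⟨_, rfl⟩ := h
  obtain ⟨_, rfl⟩ := h'
  rfl

theorem Pairs.exists_lt (e : Pairs Om1) : ∃ α β : Om1, α < β ∧ e.1 = s(α, β) := by
  obtain ⟨e, he⟩ := e
  induction e with
  | _ α β =>
    rcases lt_trichotomy α β with h | h | h
    · exact ⟨α, β, h, rfl⟩
    · exact absurd (Sym2.mk_isDiag_iff.2 h) he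
    · exact ⟨β, α, h, Sym2.eq_swap⟩

theorem eq_of_mk_eq_of_lt {α β α' β' : Om1} (h : α < β) (h' : α' < β')
    (he : s(α, β) = s(α', β')) : α = α' ∧ β = β' := by
  rcases Sym2.eq_iff.1 he with he | ⟨rfl, rfl⟩
  · exact he
  · exact absurd h h'.not_gt

/-- Conditions of height at least `β` are dense, and two of them with a common extension have the
same restrictions to `α` and `β`. -/
theorem IsCompleteCoherentSuslinTree.fIsFun_inducedName (hS : IsCompleteCoherentSuslinTree S)
    (c : Pairs S → Fin 2) (p : TreeForcing S) :
    fIsFun (inducedName hS.toIsSuslinTree c) p := by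
  refine fIsFun_of (fun e q _ => ?_) ?_
  · obtain ⟨α, β, hαβ, he⟩ := e.exists_lt
    obtain ⟨r, hr, hβ⟩ := hS.exists_ge (OrderDual.ofDual q) β
    obtain ⟨k, hk⟩ := HasColor.exists c (x := treeRestrict hS.toIsSuslinTree r α)
      (y := treeRestrict hS.toIsSuslinTree r β) fun h => hαβ.ne (by
        rw [← treeRestrict_ht hS.toIsSuslinTree (hαβ.le.trans hβ), h,
          treeRestrict_ht hS.toIsSuslinTree hβ])
    exact ⟨OrderDual.toDual r, hr, k, α, β, hαβ, he, hβ, hk⟩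
  · rintro e k k' p₁ p₂ r ⟨α, β, h, he, hβ, hk⟩ ⟨α', β', h', he', hβ', hk'⟩ hr hr'
    obtain ⟨rfl, rfl⟩ := eq_of_mk_eq_of_lt h h' (he.symm.trans he')
    dsimp only at hk hk' hβ hβ'
    rw [treeRestrict_eq_of_le _ (show OrderDual.ofDual p₁ ≤ OrderDual.ofDual r from hr) hβ,
      treeRestrict_eq_of_le _ (show OrderDual.ofDual p₁ ≤ OrderDual.ofDual r from hr)
        (h.le.trans hβ)] at hk
    rw [treeRestrict_eq_of_le _ (show OrderDual.ofDual p₂ ≤ OrderDual.ofDual r from hr') hβ',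
      treeRestrict_eq_of_le _ (show OrderDual.ofDual p₂ ≤ OrderDual.ofDual r from hr')
        (h.le.trans hβ')] at hk'
    exact hk.unique hk'

/-- A condition that forces a name to be a sequence of pairwise disjoint finite sets has
extensions that decide some late member of the sequence to lie above a given bound. -/
theorem IsSuslinTree.exists_decided_above (hS : IsSuslinTree S) {n : ℕ}
    {a : Name (TreeForcing S) (Om1 × Subsets Om1 n)} {q : TreeForcing S} (hf : fIsFun a q)
    (hd : ∀ r ≤ q, ∀ α β u v, α ≠ β → fMem (α, u) a r → fMem (β, v) a r → Disjoint u.1 v.1)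
    (δ : Om1) : ∃ α u, ∃ r ≤ q, δ < α ∧ fMem (α, u) a r ∧ ∀ ξ ∈ u.1, δ < ξ := by
  by_contra! hcon
  have hval : ∀ α, ∃ (r : S) (u : Subsets Om1 n), OrderDual.toDual r ≤ q ∧
      fMem (α, u) a (OrderDual.toDual r) := fun α => by
    obtain ⟨r, hr, u, hu⟩ := hf.exists_value le_rfl α
    exact ⟨OrderDual.ofDual r, u, hr, hu⟩
  choose r u hr hu using hval
  -- If `ξ` is in the decided sets of two indices, a common extension of their conditions would
  -- violate disjointness. So for each `ξ` these conditions are pairwise incompatible.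
  have hcount : (⋃ ξ ∈ Set.Iic δ, {α | ξ ∈ (u α).1}).Countable := by
    refine (Om1.countable_Iic δ).biUnion fun ξ _ => hS.countable_of_incompatible r ?_
    intro α hα β hβ hne v hv hv'
    refine Finset.disjoint_left.1 (hd (OrderDual.toDual v)
      (le_trans (b := OrderDual.toDual (r α)) hv (hr α)) α β _ _ hne
      ((hu α).mono hv) ((hu β).mono hv')) hα hβ
  obtain ⟨δ', hδ'⟩ := Om1.exists_gt_of_countable hcount
  obtain ⟨ξ, hξ, hle⟩ := hcon (max δ δ').next (u _) _ (hr _)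
    ((le_max_left _ _).trans_lt (Om1.lt_next _)) (hu _)
  exact (hδ' _ (Set.mem_biUnion hle hξ)).not_ge ((le_max_right δ δ').trans (Om1.lt_next _).le)

theorem forced_witness_inducedName (hS : IsCompleteCoherentSuslinTree S)
    {c : Pairs S → Fin 2} (hc : Phi0 S c) :
    Forced (fWitnessPr1 (inducedName hS.toIsSuslinTree c)) := by
  refine fun p => ⟨hS.fIsFun_inducedName c p, fun n a η => fImp_iff.2 ?_⟩
  rintro q - ⟨hf, hdis⟩
  have hd : ∀ r ≤ q, ∀ α β u v, α ≠ β → fMem (α, u) a r → fMem (β, v) a r →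
      Disjoint u.1 v.1 := fun r hr α β u v hne hu hv => by
    obtain ⟨_, _, h⟩ := fImp_iff.1 (hdis α β u v) r hr ⟨hne, hu, hv⟩
    exact h
  -- An entry consists of a condition below `q`, an index, and the set it decides at that index. The
  -- set lies below the height of the condition, as (a) requires.
  let R : Om1 → S × Om1 × Subsets Om1 n → Prop := fun δ x =>
    (δ < x.1.1.ht ∧ δ < x.2.1 ∧ ∀ ξ ∈ x.2.2.1, δ < ξ) ∧ OrderDual.toDual x.1 ≤ q ∧
      fMem x.2 a (OrderDual.toDual x.1) ∧ ∀ ξ ∈ x.2.2.1, ξ < x.1.1.ht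
  obtain ⟨g, hgR, hg⟩ := Om1.exists_seq R
    (fun δ δ' x hle hx => ⟨⟨hle.trans_lt hx.1.1, hle.trans_lt hx.1.2.1,
      fun ξ hξ => hle.trans_lt (hx.1.2.2 ξ hξ)⟩, hx.2⟩)
    (fun x => max x.1.1.ht x.2.1)
    (by
      intro δ
      obtain ⟨α, u, r, hr, hα, hu, hδ⟩ := hS.exists_decided_above hf hd δ
      obtain ⟨δ', hδ'⟩ := Om1.exists_gt_of_countable u.1.countable_toSet
      obtain ⟨v, hv, hh⟩ := hS.exists_ge (OrderDual.ofDual r) (max δ.next δ')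
      have hvr : OrderDual.toDual v ≤ r := hv
      exact ⟨(v, α, u), ⟨(Om1.lt_next δ).trans_le ((le_max_left _ _).trans hh), hα, hδ⟩,
        hvr.trans hr, hu.mono hvr,
        fun ξ hξ => (hδ' ξ hξ).trans_le ((le_max_right _ _).trans hh)⟩)
  have hg' : ∀ γ, OrderDual.toDual (g γ).1 ≤ q ∧
      fMem (g γ).2 a (OrderDual.toDual (g γ).1) ∧ ∀ ξ ∈ (g γ).2.2.1, ξ < (g γ).1.1.ht :=
    fun γ => (hgR γ).choose_spec.2
  have hht : StrictMono fun γ => (g γ).1.1.ht := fun γ δ h =>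
    (le_max_left _ _).trans_lt (hg γ δ h).1.1
  have hsep : ∀ γ δ, γ < δ → ∀ ξ ∈ (g γ).2.2.1, ∀ ζ ∈ (g δ).2.2.1, ξ < ζ :=
    fun γ δ h ξ hξ ζ hζ => ((hg' γ).2.2 ξ hξ).trans
      ((le_max_left _ _).trans_lt ((hg γ δ h).1.2.2 ζ hζ))
  obtain ⟨γ, δ, hγδ, hlt, hcol⟩ := exists_homogeneous hS hc n (fun γ => (g γ).1)
    (fun γ => (g γ).2.2) η (fun γ δ h => hht.injective (congrArg (fun x : S => x.1.ht) h))
    (fun γ => (hg' γ).2.2) (fun γ δ hne => Finset.disjoint_left.2 fun ξ h1 h2 => by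
      rcases lt_or_gt_of_ne hne with h | h
      · exact lt_irrefl ξ (hsep _ _ h ξ h1 ξ h2)
      · exact lt_irrefl ξ (hsep _ _ h ξ h2 ξ h1))
  have hle : OrderDual.toDual (g δ).1 ≤ OrderDual.toDual (g γ).1 := hlt.le
  refine ⟨OrderDual.toDual (g δ).1, (hg' δ).1, fEx_of (g γ).2.1 fun q₁ h₁ =>
    fEx_of (g δ).2.1 fun q₂ h₂ => fEx_of (g γ).2.2 fun q₃ h₃ => fEx_of (g δ).2.2 fun q₄ h₄ => ?_⟩
  have hq₄ : q₄ ≤ OrderDual.toDual (g δ).1 := h₄.trans (h₃.trans (h₂.trans h₁))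
  refine ⟨(le_max_right _ _).trans_lt (hg γ δ hγδ).1.2.1,
    ⟨(hg' γ).2.1.mono (hq₄.trans hle), (hg' δ).2.1.mono hq₄⟩, fun x y => ?_⟩
  have hxy := hsep γ δ hγδ x x.2 y y.2
  refine fEx_of ⟨s(x.1, y.1), fun hd => hxy.ne (Sym2.mk_isDiag_iff.1 hd)⟩ fun q₅ h₅ =>
    ⟨rfl, fMem.mono (fMem_of_mem ?_) (h₅.trans hq₄)⟩
  refine ⟨x, y, hxy, rfl, ((hg' δ).2.2 y y.2).le, ?_⟩
  have := hcol x x.2 y y.2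
  -- The colour was found with a restriction of `g γ`; the longer condition `g δ` has the same one.
  rwa [treeRestrict_eq_of_le _ hlt.le ((hg' γ).2.2 x x.2).le] at this

/-! ### The generic branch -/

theorem exists_le_of_fMem_branchName {q : TreeForcing S} {α : Om1} {t : S}
    (h : fMem (α, t) (branchName S) q) :
    ∃ r ≤ q, t ≤ OrderDual.ofDual r ∧ t.1.ht = α := by
  obtain ⟨r, hr, p, ⟨h₁, h₂⟩, hp⟩ := h q le_rfl
  dsimp only at h₁ h₂
  subst h₂
  exact ⟨r, hr, hp, h₁⟩

theorem IsCompleteCoherentSuslinTree.fIsFun_branchName (hS : IsCompleteCoherentSuslinTree S)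
    (p : TreeForcing S) : fIsFun (branchName S) p := by
  refine ⟨fun α => fEx_iff.2 fun q _ => ?_, fun α t t' => fImp_iff.2 fun q _ h => ?_⟩
  · obtain ⟨r, hr, hα⟩ := hS.exists_ge (OrderDual.ofDual q) α
    refine ⟨OrderDual.toDual r, hr, treeRestrict hS.toIsSuslinTree r α,
      fMem.mono (fMem_of_mem ⟨treeRestrict_ht hS.toIsSuslinTree hα, rfl⟩)
        (treeRestrict_le hS.toIsSuslinTree r α)⟩
  · obtain ⟨r, hr, hle, hα⟩ := exists_le_of_fMem_branchName h.1
    obtain ⟨r', hr', hle', hα'⟩ := exists_le_of_fMem_branchName (h.2.mono hr)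
    have hle₂ : t ≤ OrderDual.ofDual r' := le_trans hle hr'
    exact ⟨q, le_rfl, Subtype.ext (Node.eq_of_le_of_le hle₂ hle' (hα.trans hα'.symm))⟩

end TreeForcing

end SuslinForcing

open SuslinForcing in
theorem mainTheorem6 (S : Set Node) (hS : IsCompleteCoherentSuslinTree S)
    (c : Pairs S → Fin 2) (hc : Phi0 S c) :
    -- the combinatorial core, in the ground model
    (∀ (n : ℕ) (s : Om1 → S) (a : Om1 → Subsets Om1 n) (k : Fin 2),
      Function.Injective s → (∀ α, ∀ ξ ∈ (a α).1, ξ < (s α).1.ht) →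
      (∀ α β, α ≠ β → Disjoint (a α).1 (a β).1) →
      ∃ α β, α < β ∧ s α < s β ∧ ∀ ξ ∈ (a α).1, ∀ ζ ∈ (a β).1,
        HasColor c (treeRestrict hS.toIsSuslinTree (s α) ξ)
          (treeRestrict hS.toIsSuslinTree (s β) ζ) k) ∧
    -- `Pr₁(ω₁, 2, ω)` holds in the extension by `S`
    Forced (fPr1 (TreeForcing S) (Fin 2)) ∧
    -- the induced colouring is a witness
    Forced (fWitnessPr1 (inducedName hS.toIsSuslinTree c)) ∧
    -- the induced colouring satisfies `c*(α, β) = c(b(α), b(β))` for the generic branch `b`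
    Forced (fIsFun (branchName S)) ∧
    Forced (fAll fun α : Om1 => fAll fun β : Om1 => fAll fun t : S => fAll fun u : S =>
      fAll fun e : Pairs Om1 => fAll fun k : Fin 2 =>
        fImp
          (fAnd (fPure (α < β ∧ e.1 = s(α, β) ∧ HasColor c t u k))
            (fAnd (fMem (α, t) (branchName S)) (fMem (β, u) (branchName S))))
          (fMem (e, k) (inducedName hS.toIsSuslinTree c))) := by
  refine ⟨fun n s a k => exists_homogeneous hS hc n s a k, fun p => ⟨?_, ?_⟩,
    forced_witness_inducedName hS hc, hS.fIsFun_branchName, ?_⟩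
  · exact hS.forced_omega1 p
  · exact fEx_of _ fun q _ => forced_witness_inducedName hS hc q
  · intro p α β t u e k
    refine fImp_iff.2 ?_
    rintro q - ⟨⟨hαβ, he, hk⟩, ht, hu⟩
    obtain ⟨r, hr, htr, rfl⟩ := exists_le_of_fMem_branchName ht
    obtain ⟨r', hr', hur, rfl⟩ := exists_le_of_fMem_branchName (hu.mono hr)
    have htr' : t ≤ OrderDual.ofDual r' := le_trans htr hr'
    -- The condition `r'` extends both `t` and `u`, so its restrictions to their heights are `t` and
    -- `u` themselves.
    refine ⟨r', hr'.trans hr, fMem_of_mem ⟨_, _, hαβ, he, hur.1, ?_⟩⟩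
    rwa [treeRestrict_eq_self_of_le _ htr', treeRestrict_eq_self_of_le _ hur]
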